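/- Let $D\subseteq\mathbb{C}$ be a domain, that is, a non-empty open path-connected set, and let $H(D)$ be the algebra of holomorphic functions in $D$ with pointwise operations. For $f\in H(D)$ let $Z_D(f)$ be the set of zeros of $f$ in $D$, and for $\zeta\in Z_D(f)$ let $\operatorname{ord}(f,\zeta)$ be the order of $\zeta$ as a zero of $f$. An ideal $I$ of $H(D)$ is called free if $\bigcap_{f\in I}Z_D(f)=\emptyset$. The Krull intersection of $I$ is $ki(I):=\bigcap_{n=1}^\infty I^n$. (a) Let $M$ be a free maximal ideal of $H(D)$. Then 1. $\{0\}\cup\{f\in M: f\neq 0 \text{ and } \lim_{\zeta\in Z_D(f)}\operatorname{ord}(f,\zeta)=\infty\}\subseteq ki(M)$; 2. $ki(M)\subseteq\{0\}\cup\{f\in M: f\neq 0 \text{ and } \sup_{\zeta\in Z_D(f)}\operatorname{ord}(f,\zeta)=\infty\}$. Here $\lim_{\zeta\in Z_D(f)}\operatorname{ord}(f,\zeta)=\infty$ means that for every integer $n>0$ there is a finite set $K\subseteq Z_D(f)$ such that $\operatorname{ord}(f,\zeta)>n$ for all $\zeta\in Z_D(f)\setminus K$. (b) Let $M$ be any maximal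 ideal of $H(D)$, free or not. Then $ki(M)=\{0\}$ if and only if there exists $\zeta\in D$ such that $M=\langle z-\zeta\rangle$, the ideal generated by the function $z\mapsto z-\zeta$. -/

import Mathlib

namespace KrullHol

/-- The extension of a function on `D ⊆ ℂ` to all of `ℂ`, by `0` outside `D`. -/
noncomputable def ext {D : Set ℂ} (f : D → ℂ) : ℂ → ℂ :=
  Function.extend Subtype.val f 0

theorem ext_apply {D : Set ℂ} (f : D → ℂ) {z : ℂ} (hz : z ∈ D) : ext f z = f ⟨z, hz⟩ :=
  Subtype.val_injective.extend_apply f 0 ⟨z, hz⟩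

/-- `f : D → ℂ` is holomorphic: complex differentiable on `D`. (For open `D` this does not
depend on how `f` is extended outside `D`.) -/
def IsHol {D : Set ℂ} (f : D → ℂ) : Prop :=
  DifferentiableOn ℂ (ext f) D

theorem isHol_of_eqOn {D : Set ℂ} {f : D → ℂ} {F : ℂ → ℂ} (hF : DifferentiableOn ℂ F D)
    (h : ∀ z : D, f z = F z) : IsHol f :=
  hF.congr fun z hz => by rw [ext_apply f hz, h]

/-- The algebra `H(D)` of holomorphic functions in `D`, with pointwise operations. -/
noncomputable def Hol (D : Set ℂ) : Subalgebra ℂ (D → ℂ) where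
  carrier := {f | IsHol f}
  mul_mem' {f g} hf hg := isHol_of_eqOn (F := fun z => ext f z * ext g z)
    (DifferentiableOn.mul hf hg) fun z => by
      simp [ext_apply f z.2, ext_apply g z.2]
  add_mem' {f g} hf hg := isHol_of_eqOn (F := fun z => ext f z + ext g z)
    (DifferentiableOn.add hf hg) fun z => by
      simp [ext_apply f z.2, ext_apply g z.2]
  algebraMap_mem' c := isHol_of_eqOn (F := fun _ => c) (differentiableOn_const c) fun _ => rfl

/-- The function `z ↦ z - ζ` in `H(D)`. -/
noncomputable def subPoint (D : Set ℂ) (ζ : ℂ) : Hol D :=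
  ⟨fun z => (z : ℂ) - ζ, isHol_of_eqOn (F := fun z => z - ζ)
    (differentiableOn_id.sub_const ζ) fun _ => rfl⟩

/-- The zero set `Z_D(f)`. -/
def zeroSet {D : Set ℂ} (f : Hol D) : Set D :=
  {ζ | f.1 ζ = 0}

/-- The zero set `Z_D(I) = ⋂_{f ∈ I} Z_D(f)` of an ideal. -/
def idealZeroSet {D : Set ℂ} (I : Ideal (Hol D)) : Set D :=
  ⋂ f ∈ I, zeroSet f

/-- An ideal of `H(D)` is free if its zero set is empty. -/
def IsFree {D : Set ℂ} (I : Ideal (Hol D)) : Prop :=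
  idealZeroSet I = ∅

/-- The order `ord(f, ζ)` of `ζ` as a zero of `f` (it is `⊤` if `f` vanishes near `ζ`). -/
noncomputable def ord {D : Set ℂ} (f : Hol D) (ζ : D) : ℕ∞ :=
  analyticOrderAt (ext f.1) (ζ : ℂ)

/-- `lim_{ζ ∈ Z_D(f)} ord(f, ζ) = ∞`: for every `n > 0`, all but finitely many zeros of `f` have
order larger than `n`. -/
def OrdTendsToInfty {D : Set ℂ} (f : Hol D) : Prop :=
  ∀ n : ℕ, 0 < n → ∃ K : Set D, K.Finite ∧ K ⊆ zeroSet f ∧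
    ∀ ζ ∈ zeroSet f \ K, (n : ℕ∞) < ord f ζ

/-- The Krull intersection `ki(I) = ⋂_{n ≥ 1} I ^ n` of an ideal. -/
def ki {R : Type*} [CommRing R] (I : Ideal R) : Ideal R :=
  ⨅ (n : ℕ) (_ : 1 ≤ n), I ^ n

end KrullHol

open Filter Topology

/-! In `H(D)` divisibility is decided by orders of zeros (`dvd_of_ord_le`). The Weierstrass theorem
realises any orders supported on the zeros of a nonzero function (`exists_ord_eq`). With
Mittag-Leffler it makes `H(D)` a Bézout ring (`exists_gcd`), so each element of `M ^ n` is divisible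
by `d ^ n` for a single `d ∈ M`.

Lower inclusion: let `h` have order `⌊ord f / n⌋` everywhere, so `h ^ n ∣ f`. If the orders of `f`
tend to infinity, then `f ∣ P * h ^ (2 * n)` with `P` a finite product of factors `z - ζ`. A free
maximal ideal contains no such factor, so primality gives `h ∈ M` and `f ∈ M ^ n`.

Upper inclusion: if `d ^ n ∣ f` with `d ∈ M`, then `d` is not a unit, hence has a zero, where `f`
has order at least `n`.

Part (b): for free `M`, raising the orders of a nonzero `f ∈ M` along a compact exhaustion gives a
nonzero element of `ki M`. A maximal ideal that is not free is some `⟨z - ζ⟩`, and an element of its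
Krull intersection has infinite order at `ζ`, so it vanishes by the identity theorem. -/

namespace KrullHol

/-! ### Peak functions, gluing, and small local terms -/

/-- For every point `a` of an open set `D` there is a holomorphic `u a` without zeros on `D`, such
that `1 - (z - a) * u a z` is small on a given compact set unless `a` lies in some other compact
set. -/
theorem exists_peak_functions {D : Set ℂ} (hD : IsOpen D) : ∃ u : ℂ → ℂ → ℂ,
    (∀ a ∈ D, DifferentiableOn ℂ (u a) D ∧ ∀ z ∈ D, u a z ≠ 0) ∧
    ∀ K ⊆ D, IsCompact K → ∃ K' ⊆ D, IsCompact K' ∧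
      ∀ a ∈ D, a ∉ K' → ∀ z ∈ K, ‖1 - (z - a) * u a z‖ ≤ 1 / 2 := by
  by_cases hne : (Dᶜ).Nonempty
  · have hF : IsClosed Dᶜ := hD.isClosed_compl
    choose b hbF hb using fun a : ℂ => hF.exists_infDist_eq_dist hne a
    have hpos : ∀ a ∈ D, 0 < Metric.infDist a Dᶜ := fun a ha =>
      (hF.notMem_iff_infDist_pos hne).1 fun h => h ha
    -- Two regimes: for `a` far out, `u = -1/a` and `1 - (z - a) * u = z / a`. For `a` near the
    -- boundary, `u = 1 / (z - b)` with `b` a nearest point of the complement, and the expression is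
    -- `(a - b) / (z - b)`.
    refine ⟨fun a z => if 1 ≤ ‖a‖ * Metric.infDist a Dᶜ then -a⁻¹ else (z - b a)⁻¹, ?_, ?_⟩
    · intro a ha
      by_cases h : 1 ≤ ‖a‖ * Metric.infDist a Dᶜ
      · have ha0 : a ≠ 0 := by
          rintro rfl
          simp at h
          linarith
        simp only [h, if_true]
        exact ⟨differentiableOn_const _, fun z _ => by simpa using ha0⟩
      · simp only [h, if_false]
        have hz : ∀ z ∈ D, z - b a ≠ 0 := fun z hz h => hbF a (sub_eq_zero.1 h ▸ hz)
        exact ⟨(differentiableOn_id.sub_const _).inv hz, fun z h => inv_ne_zero (hz z h)⟩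
    · intro K hKD hK
      obtain ⟨δ, hδ, hKδ⟩ := hK.exists_cthickening_subset_open hD hKD
      obtain ⟨R, hR, hKR⟩ := hK.isBounded.exists_pos_norm_le
      -- With these thresholds, `a` outside the compact set has `‖a‖ ≥ 2R` in the first regime and
      -- distance at most `δ / 2` to the complement in the second.
      set ρ := max (2 * R) (2 / δ)
      set η := min (1 / (2 * R)) (δ / 2)
      have hη : 0 < η := lt_min (by positivity) (by positivity)
      refine ⟨Metric.closedBall 0 ρ ∩ {a | η ≤ Metric.infDist a Dᶜ}, ?_, ?_, ?_⟩
      · rintro a ⟨-, ha⟩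
        by_contra h
        have : Metric.infDist a Dᶜ = 0 := Metric.infDist_zero_of_mem h
        simp only [Set.mem_ofPred_eq] at ha
        linarith
      · exact (isCompact_closedBall 0 ρ).inter_right
          (isClosed_le continuous_const (Metric.continuous_infDist_pt _))
      · intro a ha haK z hz
        have hr := hpos a ha
        have hz' := hKR z hz
        simp only [Set.mem_inter_iff, mem_closedBall_zero_iff, Set.mem_ofPred_eq, not_and,
          not_le] at haK
        by_cases h : 1 ≤ ‖a‖ * Metric.infDist a Dᶜ
        · have ha0 : 0 < ‖a‖ := by
            by_contra h0
            have : ‖a‖ = 0 := le_antisymm (not_lt.1 h0) (norm_nonneg _)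
            rw [this] at h
            linarith
          have h2 : 2 * R ≤ ‖a‖ := by
            by_contra! h2
            have h3 := haK (h2.le.trans (le_max_left _ _))
            have h4 : 1 / (2 * R) ≤ Metric.infDist a Dᶜ := by
              rw [div_le_iff₀ (by positivity)]
              nlinarith
            linarith [min_le_left (1 / (2 * R)) (δ / 2)]
          simp only [h, if_true]
          have : 1 - (z - a) * -a⁻¹ = z / a := by
            have : a ≠ 0 := norm_pos_iff.1 ha0
            field_simp
            ring
          rw [this, norm_div, div_le_iff₀ ha0]
          linarith
        · simp only [h, if_false]
          have h2 : Metric.infDist a Dᶜ ≤ δ / 2 := by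
            by_contra! h2
            have h3 : ‖a‖ ≤ 2 / δ := by
              rw [le_div_iff₀ hδ]
              nlinarith [norm_nonneg a]
            linarith [haK (h3.trans (le_max_right _ _)), min_le_right (1 / (2 * R)) (δ / 2)]
          have h3 : δ < ‖z - b a‖ := by
            by_contra! h3
            refine hbF a (hKδ (Metric.mem_cthickening_of_dist_le _ z δ K hz ?_))
            rwa [dist_comm, dist_eq_norm]
          have h4 : z - b a ≠ 0 := norm_pos_iff.1 (hδ.trans h3)
          have : 1 - (z - a) * (z - b a)⁻¹ = (a - b a) / (z - b a) := by
            field_simp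
            ring
          rw [this, norm_div, div_le_iff₀ (hδ.trans h3), ← dist_eq_norm, ← hb a]
          linarith
  · have hU : D = Set.univ := by
      rwa [Set.not_nonempty_iff_eq_empty, Set.compl_empty_iff] at hne
    subst hU
    refine ⟨fun a _ => if a = 0 then 1 else -a⁻¹, fun a _ => ⟨differentiableOn_const _, ?_⟩, ?_⟩
    · intro z _
      by_cases h : a = 0 <;> simp [h]
    · intro K _ hK
      obtain ⟨R, hR, hKR⟩ := hK.isBounded.exists_pos_norm_le
      refine ⟨Metric.closedBall 0 (2 * R), Set.subset_univ _, isCompact_closedBall _ _, ?_⟩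
      intro a _ ha z hz
      simp only [mem_closedBall_zero_iff, not_le] at ha
      have ha0 : a ≠ 0 := norm_pos_iff.1 (by linarith)
      have : 1 - (z - a) * -a⁻¹ = z / a := by
        field_simp
        ring
      simp only [ha0, if_false]
      rw [this, norm_div, div_le_iff₀ (by linarith)]
      linarith [hKR z hz]

theorem exists_compact_exhaustion {D : Set ℂ} (hD : IsOpen D) : ∃ K : ℕ → Set ℂ,
    (∀ n, IsCompact (K n)) ∧ (∀ n, K n ⊆ D) ∧ Monotone K ∧
      ∀ C ⊆ D, IsCompact C → ∃ n, C ⊆ K n := by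
  have := hD.locallyCompactSpace
  let E := CompactExhaustion.choice D
  refine ⟨fun n => Subtype.val '' E n, fun n => (E.isCompact n).image continuous_subtype_val,
    fun n => Subtype.coe_image_subset D (E n), fun m n h => Set.image_mono (E.subset h), ?_⟩
  intro C hC hc
  obtain ⟨n, hn⟩ := E.exists_superset_of_isCompact
    ((Subtype.isCompact_iff (s := (Subtype.val ⁻¹' C : Set D))).2 (by simpa [Set.inter_eq_right.2 hC] using hc))
  exact ⟨n, fun z hz => ⟨⟨z, hC hz⟩, hn hz, rfl⟩⟩

/-- Local analytic extensions over points glue together. -/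
theorem exists_analytic_of_local {D : Set ℂ} {F : ℂ → ℂ}
    (h : ∀ a ∈ D, ∃ G, AnalyticAt ℂ G a ∧ F =ᶠ[𝓝[≠] a] G) :
    ∃ H, ∀ a ∈ D, AnalyticAt ℂ H a ∧ F =ᶠ[𝓝[≠] a] H := by
  refine ⟨fun z => limUnder (𝓝[≠] z) F, fun a ha => ?_⟩
  obtain ⟨G, hG, hFG⟩ := h a ha
  have key : (fun z => limUnder (𝓝[≠] z) F) =ᶠ[𝓝 a] G := by
    have h1 : ∀ᶠ z in 𝓝 a, F =ᶠ[𝓝[≠] z] G := by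
      have h2 := eventually_eventually_nhdsWithin.2 hFG
      rw [eventually_nhdsWithin_iff] at h2
      filter_upwards [h2] with z hz
      rcases eq_or_ne z a with rfl | hne
      · exact hFG
      · exact ((hz hne).filter_mono (nhdsWithin_le_of_mem
          (mem_nhdsWithin_of_mem_nhds (isOpen_ne.mem_nhds hne))))
    filter_upwards [h1, hG.eventually_analyticAt] with z hz hGz
    exact ((hGz.continuousAt.tendsto.mono_left nhdsWithin_le_nhds).congr' hz.symm).limUnder_eq
  exact ⟨hG.congr key.symm, hFG.trans (key.symm.filter_mono nhdsWithin_le_nhds)⟩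

/-- Taylor expansion with analytic remainder. -/
theorem exists_entire_add_pow_mul {G : ℂ → ℂ} {a : ℂ} (hG : AnalyticAt ℂ G a) (k : ℕ) :
    ∃ p R : ℂ → ℂ, Differentiable ℂ p ∧ AnalyticAt ℂ R a ∧
      ∀ z, G z = p z + (z - a) ^ k * R z := by
  induction k with
  | zero => exact ⟨0, G, differentiable_const 0, hG, by simp⟩
  | succ k ih =>
    obtain ⟨p, R, hp, hR, h⟩ := ih
    obtain ⟨q, hq⟩ := hR
    refine ⟨fun z => p z + (z - a) ^ k * R a, dslope R a, by fun_prop,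
      ⟨_, hq.has_fpower_series_dslope_fslope⟩, fun z => ?_⟩
    have := sub_smul_dslope R a z
    rw [smul_eq_mul] at this
    rw [h, pow_succ, mul_assoc, this]
    ring

/-- The Weierstrass M-test. The finite set `S` collects the terms that may be singular or too large
on `U`; they are handled separately. -/
theorem exists_hasSum_off_finset {ι : Type*} [DecidableEq ι] {F : ι → ℂ → ℂ} {ε : ι → ℝ}
    (hε : Summable ε)
    (hε0 : ∀ i, 0 ≤ ε i) {S : Finset ι} {U : Set ℂ} (hU : IsOpen U)
    (hF : ∀ i ∉ S, DifferentiableOn ℂ (F i) U) (hb : ∀ i ∉ S, ∀ z ∈ U, ‖F i z‖ ≤ ε i) :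
    ∃ T, DifferentiableOn ℂ T U ∧
      ∀ z ∈ U, HasSum (fun i => if i ∈ S then 0 else F i z) (T z) := by
  have hb' : ∀ i, ∀ z ∈ U, ‖if i ∈ S then 0 else F i z‖ ≤ ε i := by
    intro i z hz
    split_ifs with h
    · simpa using hε0 i
    · exact hb i h z hz
  refine ⟨fun z => ∑' i, if i ∈ S then 0 else F i z,
    Complex.differentiableOn_tsum_of_summable_norm (F := fun i z => if i ∈ S then 0 else F i z)
      hε (fun i => ?_) hU hb', fun z hz => ?_⟩
  · by_cases h : i ∈ S
    · simp only [h, if_true]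
      exact differentiableOn_const _
    · simp only [h, if_false]
      exact hF i h
  · exact (Summable.of_norm_bounded hε fun i => hb' i z hz).hasSum

/-- A function with a prescribed principal part at `a` that is small on the part of a compact set
where `1 - (z - a) * u z` is small. -/
theorem exists_small_principal_part {D K : Set ℂ} (hKD : K ⊆ D) (hK : IsCompact K) {a : ℂ}
    {u p : ℂ → ℂ} (hu : DifferentiableOn ℂ u D) (hp : Differentiable ℂ p) (k : ℕ) {ε : ℝ}
    (hε : 0 < ε) : ∃ t R : ℂ → ℂ, DifferentiableOn ℂ R D ∧
      (∀ z, z ≠ a → t z = p z / (z - a) ^ k + R z) ∧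
      ∀ z ∈ K, ‖1 - (z - a) * u z‖ ≤ 1 / 2 → ‖t z‖ ≤ ε := by
  -- Where `‖1 - (z - a) * u‖ ≤ 1 / 2` one has `‖2 * u * (z - a)‖ ≥ 1`, so this `B` gives `‖p‖ ≤ B *
  -- ‖z - a‖ ^ k` and absorbs the denominator.
  obtain ⟨B, hB, hKB⟩ := (hK.image_of_continuousOn (f := fun z => p z * (2 * u z) ^ k)
    (hp.continuous.continuousOn.mul ((continuousOn_const.mul
      (hu.continuousOn.mono hKD)).pow k))).isBounded.exists_pos_norm_le
  obtain ⟨δ, hδ, hδB⟩ : ∃ δ > 0, ∀ x : ℂ, ‖x‖ < δ → ‖1 - (1 - x) ^ k‖ ≤ ε / B := by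
    have hc : Continuous fun x : ℂ => ‖1 - (1 - x) ^ k‖ := by fun_prop
    have h0 : ∀ᶠ x in 𝓝 (0 : ℂ), ‖1 - (1 - x) ^ k‖ < ε / B :=
      hc.continuousAt.eventually_lt_const (by simpa using div_pos hε hB)
    obtain ⟨δ, hδ, h⟩ := Metric.eventually_nhds_iff.1 h0
    exact ⟨δ, hδ, fun x hx => (h (by simpa using hx)).le⟩
  obtain ⟨N, hN⟩ := exists_pow_lt_of_lt_one hδ (by norm_num : (1 / 2 : ℝ) < 1)
  set w : ℂ → ℂ := fun z => 1 - (z - a) * u z with hw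
  have hwd : DifferentiableOn ℂ w D := by
    simp only [hw]
    fun_prop
  -- The geometric sum shows that `z - a` divides `1 - w ^ N`, so subtracting `p * (1 - w ^ N) ^ k /
  -- (z - a) ^ k` leaves the principal part unchanged; what remains is small where `w ^ N` is.
  refine ⟨fun z => p z * (1 - (1 - w z ^ N) ^ k) / (z - a) ^ k,
    fun z => -(p z * (u z * ∑ j ∈ Finset.range N, w z ^ j) ^ k), ?_, ?_, ?_⟩
  · have := hp.differentiableOn (s := D)
    fun_prop
  · intro z hz
    have h1 : 1 - w z ^ N = (z - a) * (u z * ∑ j ∈ Finset.range N, w z ^ j) := by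
      rw [← mul_assoc, ← mul_neg_geom_sum]
      simp [hw]
    have h2 : (z - a) ^ k ≠ 0 := pow_ne_zero _ (sub_ne_zero.2 hz)
    simp only [h1, mul_pow]
    field_simp
    ring
  · intro z hz hwz
    have h1 : 1 / 2 ≤ ‖(z - a) * u z‖ := by
      have := norm_sub_norm_le (1 : ℂ) ((z - a) * u z)
      rw [norm_one] at this
      linarith
    have hza : 0 < ‖z - a‖ := by
      by_contra! h
      rw [norm_mul, le_antisymm h (norm_nonneg _)] at h1
      norm_num at h1
    have h2 : ‖p z‖ ≤ B * ‖z - a‖ ^ k := by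
      have h3 := hKB _ ⟨z, hz, rfl⟩
      simp only [norm_mul, norm_pow] at h3 h1
      have h4 : 1 ≤ (‖(2 : ℂ)‖ * ‖u z‖ * ‖z - a‖) ^ k := by
        apply one_le_pow₀
        rw [Complex.norm_ofNat]
        linarith
      calc ‖p z‖ = ‖p z‖ * 1 := (mul_one _).symm
        _ ≤ ‖p z‖ * (‖(2 : ℂ)‖ * ‖u z‖ * ‖z - a‖) ^ k := by gcongr
        _ = ‖p z‖ * (‖(2 : ℂ)‖ * ‖u z‖) ^ k * ‖z - a‖ ^ k := by rw [mul_pow]; ring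
        _ ≤ _ := by gcongr
    have h3 : ‖1 - (1 - w z ^ N) ^ k‖ ≤ ε / B := by
      apply hδB
      rw [norm_pow]
      exact (pow_le_pow_left₀ (norm_nonneg _) hwz N).trans_lt hN
    rw [norm_div, norm_mul, norm_pow, div_le_iff₀ (by positivity)]
    calc ‖p z‖ * ‖1 - (1 - w z ^ N) ^ k‖ ≤ (B * ‖z - a‖ ^ k) * (ε / B) := by gcongr
      _ = ε * ‖z - a‖ ^ k := by field_simp

/-- A local factor with a single zero at `a`, close to `1` where `1 - (z - a) * u z` is small. -/
theorem exists_weierstrass_factor {D : Set ℂ} {a : ℂ} {u : ℂ → ℂ} (hD : IsOpen D)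
    (hu : DifferentiableOn ℂ u D) (hu0 : ∀ z ∈ D, u z ≠ 0) (k : ℕ) {ε : ℝ} (hε : 0 < ε) :
    ∃ V L : ℂ → ℂ, DifferentiableOn ℂ V D ∧ (∀ z ∈ D, V z ≠ 0) ∧
      ∀ z ∈ D, ‖1 - (z - a) * u z‖ ≤ 1 / 2 →
        DifferentiableAt ℂ L z ∧ ‖L z‖ ≤ ε ∧ (z - a) ^ k * V z = Complex.exp (L z) := by
  obtain ⟨N, hN⟩ := exists_pow_lt_of_lt_one (show 0 < ε / (2 * (k + 1)) by positivity)
    (by norm_num : (1 / 2 : ℝ) < 1)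
  have hT : Differentiable ℂ (Complex.logTaylor (N + 1)) := fun z =>
    (Complex.hasDerivAt_logTaylor N z).differentiableAt
  set x : ℂ → ℂ := fun z => -(1 - (z - a) * u z) with hx
  have hxd : DifferentiableOn ℂ x D := by
    simp only [hx]
    fun_prop
  -- A Weierstrass elementary factor: `(z - a) * u = 1 + x`, and the exponential cancels the Taylor
  -- polynomial of `log (1 + x)`, leaving only its remainder.
  refine ⟨fun z => (u z * Complex.exp (-Complex.logTaylor (N + 1) (x z))) ^ k,
    fun z => k * (Complex.log (1 + x z) - Complex.logTaylor (N + 1) (x z)), ?_, ?_, ?_⟩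
  · have : DifferentiableOn ℂ (fun z => Complex.logTaylor (N + 1) (x z)) D :=
      hT.comp_differentiableOn hxd
    fun_prop
  · exact fun z hz => pow_ne_zero _ (mul_ne_zero (hu0 z hz) (Complex.exp_ne_zero _))
  · intro z hz hwz
    rw [← norm_neg] at hwz
    change ‖x z‖ ≤ 1 / 2 at hwz
    have hlt : ‖x z‖ < 1 := by linarith
    have hxz : DifferentiableAt ℂ x z := hxd.differentiableAt (hD.mem_nhds hz)
    have hs := Complex.mem_slitPlane_of_norm_lt_one hlt
    refine ⟨?_, ?_, ?_⟩
    · have h1 : DifferentiableAt ℂ (fun z => Complex.logTaylor (N + 1) (x z)) z :=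
        (hT _).comp z hxz
      have h2 : DifferentiableAt ℂ (fun z => Complex.log (1 + x z)) z :=
        (hxz.const_add 1).clog hs
      fun_prop
    · have h1 := Complex.norm_log_sub_logTaylor_le N hlt
      have h2 : ‖x z‖ ^ (N + 1) * (1 - ‖x z‖)⁻¹ / (N + 1) ≤ ε / (k + 1) := by
        calc ‖x z‖ ^ (N + 1) * (1 - ‖x z‖)⁻¹ / (N + 1)
            ≤ ‖x z‖ ^ (N + 1) * (1 - ‖x z‖)⁻¹ := by
              apply div_le_self
              · have : 0 ≤ 1 - ‖x z‖ := by linarith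
                positivity
              · have : (0 : ℝ) ≤ N := Nat.cast_nonneg N
                linarith
          _ ≤ (1 / 2) ^ N * 2 := by
              apply mul_le_mul
              · calc ‖x z‖ ^ (N + 1) ≤ ‖x z‖ ^ N :=
                      pow_le_pow_of_le_one (norm_nonneg _) hlt.le (Nat.le_succ N)
                  _ ≤ _ := pow_le_pow_left₀ (norm_nonneg _) hwz N
              · rw [inv_le_comm₀ (by linarith) (by norm_num)]
                linarith
              · exact inv_nonneg.2 (by linarith)
              · positivity
          _ ≤ ε / (2 * (k + 1)) * 2 := by gcongr
          _ = ε / (k + 1) := by field_simp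
      rw [norm_mul, Complex.norm_natCast]
      calc (k : ℝ) * ‖Complex.log (1 + x z) - Complex.logTaylor (N + 1) (x z)‖
          ≤ (k + 1) * (ε / (k + 1)) := by
            gcongr
            · linarith
            · exact h1.trans h2
        _ = ε := by field_simp
    · rw [Complex.exp_nat_mul, ← mul_pow, Complex.exp_sub, Complex.exp_log
        (Complex.slitPlane_ne_zero hs), Complex.exp_neg, div_eq_mul_inv]
      simp only [hx]
      ring

/-! ### Mittag-Leffler and Weierstrass theorems -/

variable {D : Set ℂ} {k : ℂ → ℕ}

/-- The index set and majorants common to Mittag-Leffler and Weierstrass series. -/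
theorem exists_cover_data (hD : IsOpen D)
    (hk : ∀ K ⊆ D, IsCompact K → {z ∈ K | k z ≠ 0}.Finite) :
    ∃ (u : ℂ → ℂ → ℂ) (C : ℂ → Set ℂ) (ε : {a // a ∈ D ∧ k a ≠ 0} → ℝ),
      (∀ a ∈ D, DifferentiableOn ℂ (u a) D ∧ ∀ z ∈ D, u a z ≠ 0) ∧
      (∀ a, C a ⊆ D ∧ IsCompact (C a)) ∧ (∀ i, 0 < ε i) ∧ Summable ε ∧
      ∀ z₀ ∈ D, ∃ (U : Set ℂ) (S : Finset {a // a ∈ D ∧ k a ≠ 0}), IsOpen U ∧ z₀ ∈ U ∧ U ⊆ D ∧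
        (∀ i : {a // a ∈ D ∧ k a ≠ 0}, (i : ℂ) = z₀ → i ∈ S) ∧
        ∀ i ∉ S, (i : ℂ) ∉ U ∧ ∀ z ∈ U, z ∈ C i ∧ ‖1 - (z - i) * u i z‖ ≤ 1 / 2 := by
  obtain ⟨u, hu, hu'⟩ := exists_peak_functions hD
  obtain ⟨K, hKc, hKD, hKm, hK⟩ := exists_compact_exhaustion hD
  have hex : ∀ a ∈ D, ∃ n, a ∈ K n := fun a ha => by
    obtain ⟨n, hn⟩ := hK {a} (by simpa using ha) isCompact_singleton
    exact ⟨n, hn rfl⟩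
  have : Countable {a // a ∈ D ∧ k a ≠ 0} := by
    have : {a | a ∈ D ∧ k a ≠ 0} ⊆ ⋃ n, {z ∈ K n | k z ≠ 0} := fun a ha => by
      obtain ⟨n, hn⟩ := hex a ha.1
      exact Set.mem_iUnion.2 ⟨n, hn, ha.2⟩
    exact ((Set.countable_iUnion fun n => (hk _ (hKD n) (hKc n)).countable).mono this).to_subtype
  obtain ⟨ε, hε, s, hs, -⟩ :=
    NNReal.exists_pos_sum_of_countable one_ne_zero {a // a ∈ D ∧ k a ≠ 0}
  classical
  -- `C a` is the first exhausting set containing `a`; hence `K n ⊆ C a` whenever `a ∈ D` lies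
  -- outside `K n`.
  refine ⟨u, fun a => if h : ∃ n, a ∈ K n then K (Nat.find h) else ∅, fun i => ε i, hu, ?_,
    fun i => NNReal.coe_pos.2 (hε i), NNReal.summable_coe.2 hs.summable, ?_⟩
  · intro a
    by_cases h : ∃ n, a ∈ K n
    · simpa only [h, dif_pos] using ⟨hKD _, hKc _⟩
    · simp [h]
  · intro z₀ hz₀
    obtain ⟨Q, hQ, hzQ, hQD⟩ := exists_compact_subset hD hz₀
    obtain ⟨Q', hQ'D, hQ', hQQ'⟩ := hu' Q hQD hQ
    obtain ⟨n, hn⟩ := hK Q hQD hQ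
    have hfin : {i : {a // a ∈ D ∧ k a ≠ 0} | (i : ℂ) ∈ Q' ∪ K n}.Finite := by
      refine Set.Finite.of_finite_image ((hk (Q' ∪ K n) (Set.union_subset hQ'D (hKD n))
        (hQ'.union (hKc n))).subset ?_) Subtype.val_injective.injOn
      rintro _ ⟨i, hi, rfl⟩
      exact ⟨hi, i.2.2⟩
    refine ⟨interior Q, hfin.toFinset, isOpen_interior, hzQ, interior_subset.trans hQD, ?_, ?_⟩
    · intro i hi
      simp only [Set.Finite.mem_toFinset, Set.mem_ofPred_eq, hi]
      exact Or.inr (hn (interior_subset hzQ))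
    · intro i hi
      simp only [Set.Finite.mem_toFinset, Set.mem_ofPred_eq, Set.mem_union, not_or] at hi
      refine ⟨fun h => hi.2 (hn (interior_subset h)), fun z hz => ⟨?_, ?_⟩⟩
      · have h := hex i i.2.1
        simp only [h, dif_pos]
        refine hKm ?_ (hn (interior_subset hz))
        by_contra! hlt
        exact hi.2 (hKm hlt.le (Nat.find_spec h))
      · exact hQQ' i i.2.1 hi.1 z (interior_subset hz)

/-- **Mittag-Leffler theorem** on an open set. -/
theorem mittag_leffler (hD : IsOpen D) (hk : ∀ K ⊆ D, IsCompact K → {z ∈ K | k z ≠ 0}.Finite)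
    {p : ℂ → ℂ → ℂ} (hp : ∀ a, Differentiable ℂ (p a)) :
    ∃ m : ℂ → ℂ, ∀ a ∈ D, ∃ R, AnalyticAt ℂ R a ∧
      ∀ᶠ z in 𝓝[≠] a, m z = p a z / (z - a) ^ k a + R z := by
  classical
  obtain ⟨u, C, ε, hu, hC, hε, hεs, hloc⟩ := exists_cover_data hD hk
  choose t R hR htR ht using fun i : {a // a ∈ D ∧ k a ≠ 0} =>
    exists_small_principal_part (hC i).1 (hC i).2 (a := i) (hu i i.2.1).1 (hp i) (k i) (hε i)
  refine ⟨fun z => ∑' i, t i z, fun a ha => ?_⟩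
  obtain ⟨U, S, hU, haU, hUD, haS, hS⟩ := hloc a ha
  have hana : ∀ i : {a // a ∈ D ∧ k a ≠ 0}, ∀ z ∈ D, z ≠ i → AnalyticAt ℂ (t i) z := by
    intro i z hz hzi
    have h1 : AnalyticAt ℂ (fun z => p i z / (z - i) ^ k i + R i z) z := by
      refine AnalyticAt.add (AnalyticAt.div ((hp i).analyticAt z) (by fun_prop)
        (pow_ne_zero _ (sub_ne_zero.2 hzi))) ((hR i).analyticAt (hD.mem_nhds hz))
    refine h1.congr ?_
    filter_upwards [isOpen_ne.mem_nhds hzi] with y hy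
    exact (htR i y hy).symm
  obtain ⟨T, hT, hTs⟩ := exists_hasSum_off_finset hεs (fun i => (hε i).le) hU
    (F := t) (S := S)
    (fun i hi z hz => (hana i z (hUD hz) fun h => (hS i hi).1 (h ▸ hz)).differentiableAt
      |>.differentiableWithinAt)
    (fun i hi z hz => ht i z ((hS i hi).2 z hz).1 ((hS i hi).2 z hz).2)
  have hsum : ∀ z ∈ U, ∑' i, t i z = T z + ∑ i ∈ S, t i z := by
    intro z hz
    have h2 : HasSum (fun i => if i ∈ S then t i z else 0) (∑ i ∈ S, t i z) := by
      have h := hasSum_sum_of_ne_finset_zero (s := S) (f := fun i => if i ∈ S then t i z else 0)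
        (L := .unconditional _) (fun i hi => if_neg hi)
      rwa [Finset.sum_congr rfl fun i hi => if_pos hi] at h
    refine HasSum.tsum_eq ?_
    convert (hTs z hz).add h2 using 2 with i
    split_ifs <;> simp
  have hTa : AnalyticAt ℂ T a := hT.analyticAt (hU.mem_nhds haU)
  by_cases hka : k a = 0
  · refine ⟨fun z => T z + ∑ i ∈ S, t i z - p a z, ?_, ?_⟩
    · refine (hTa.add (Finset.analyticAt_fun_sum _ fun i _ => hana i a ha ?_)).sub
        ((hp a).analyticAt a)
      rintro rfl
      exact i.2.2 hka
    · filter_upwards [mem_nhdsWithin_of_mem_nhds (hU.mem_nhds haU)] with z hz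
      rw [hsum z hz, hka]
      simp
  · set j : {a // a ∈ D ∧ k a ≠ 0} := ⟨a, ha, hka⟩ with hj
    refine ⟨fun z => T z + ∑ i ∈ S.erase j, t i z + R j z, ?_, ?_⟩
    · refine (hTa.add (Finset.analyticAt_fun_sum _ fun i hi => hana i a ha ?_)).add
        ((hR j).analyticAt (hD.mem_nhds ha))
      intro h
      exact Finset.ne_of_mem_erase hi (Subtype.ext h.symm)
    · filter_upwards [mem_nhdsWithin_of_mem_nhds (hU.mem_nhds haU), self_mem_nhdsWithin]
        with z hz hza
      rw [hsum z hz, ← Finset.add_sum_erase S _ (haS j rfl), htR j z hza]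
      simp only [hj]
      ring

/-- **Weierstrass theorem** on an open set: existence of a holomorphic function with prescribed
zeros. -/
theorem weierstrass (hD : IsOpen D) (hk : ∀ K ⊆ D, IsCompact K → {z ∈ K | k z ≠ 0}.Finite) :
    ∃ h : ℂ → ℂ, ∀ a ∈ D, ∃ R, AnalyticAt ℂ R a ∧ R a ≠ 0 ∧
      ∀ᶠ z in 𝓝 a, h z = (z - a) ^ k a * R z := by
  classical
  obtain ⟨u, C, ε, hu, hC, hε, hεs, hloc⟩ := exists_cover_data hD hk
  choose V L hV hV0 hL using fun i : {a // a ∈ D ∧ k a ≠ 0} =>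
    exists_weierstrass_factor (a := i) hD (hu i i.2.1).1 (hu i i.2.1).2 (k i) (hε i)
  refine ⟨fun z => ∏' i : {a // a ∈ D ∧ k a ≠ 0}, (z - i) ^ k i * V i z, fun a ha => ?_⟩
  obtain ⟨U, S, hU, haU, hUD, haS, hS⟩ := hloc a ha
  obtain ⟨T, hT, hTs⟩ := exists_hasSum_off_finset hεs (fun i => (hε i).le) hU
    (F := L) (S := S)
    (fun i hi z hz => (hL i z (hUD hz) ((hS i hi).2 z hz).2).1.differentiableWithinAt)
    (fun i hi z hz => (hL i z (hUD hz) ((hS i hi).2 z hz).2).2.1)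
  have hprod : ∀ z ∈ U, ∏' i : {a // a ∈ D ∧ k a ≠ 0}, (z - i) ^ k i * V i z =
      Complex.exp (T z) * ∏ i ∈ S, (z - (i : ℂ)) ^ k i * V i z := by
    intro z hz
    have h2 : HasProd (fun i : {a // a ∈ D ∧ k a ≠ 0} => if i ∈ S then (z - i) ^ k i * V i z else 1)
        (∏ i ∈ S, (z - (i : ℂ)) ^ k i * V i z) := by
      have h := hasProd_prod_of_ne_finset_one (s := S)
        (f := fun i : {a // a ∈ D ∧ k a ≠ 0} => if i ∈ S then (z - i) ^ k i * V i z else 1)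
        (L := .unconditional _) (fun i hi => if_neg hi)
      rwa [Finset.prod_congr rfl fun i hi => if_pos hi] at h
    refine HasProd.tprod_eq ?_
    convert (hTs z hz).cexp.mul h2 using 1
    funext i
    by_cases hi : i ∈ S
    · simp [hi]
    · simp [hi, (hL i z (hUD hz) ((hS i hi).2 z hz).2).2.2]
  have hTa : AnalyticAt ℂ T a := hT.analyticAt (hU.mem_nhds haU)
  have hVa : ∀ i, AnalyticAt ℂ (V i) a := fun i => (hV i).analyticAt (hD.mem_nhds ha)
  have hfac : ∀ i : {a // a ∈ D ∧ k a ≠ 0}, AnalyticAt ℂ (fun z => (z - i) ^ k i * V i z) a :=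
    fun i => AnalyticAt.mul (by fun_prop) (hVa i)
  have hfac0 : ∀ i : {a // a ∈ D ∧ k a ≠ 0}, a ≠ i → (a - i) ^ k i * V i a ≠ 0 := fun i hi =>
    mul_ne_zero (pow_ne_zero _ (sub_ne_zero.2 hi)) (hV0 i a ha)
  by_cases hka : k a = 0
  · refine ⟨fun z => Complex.exp (T z) * ∏ i ∈ S, (z - (i : ℂ)) ^ k i * V i z, ?_, ?_, ?_⟩
    · exact hTa.cexp.mul (Finset.analyticAt_fun_prod _ fun i _ => hfac i)
    · refine mul_ne_zero (Complex.exp_ne_zero _) (Finset.prod_ne_zero_iff.2 fun i _ => hfac0 i ?_)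
      rintro rfl
      exact i.2.2 hka
    · filter_upwards [hU.mem_nhds haU] with z hz
      rw [hprod z hz, hka]
      simp
  · set j : {a // a ∈ D ∧ k a ≠ 0} := ⟨a, ha, hka⟩ with hj
    refine ⟨fun z => Complex.exp (T z) * (V j z * ∏ i ∈ S.erase j, (z - i) ^ k i * V i z),
      ?_, ?_, ?_⟩
    · exact hTa.cexp.mul ((hVa j).mul (Finset.analyticAt_fun_prod _ fun i _ => hfac i))
    · refine mul_ne_zero (Complex.exp_ne_zero _) (mul_ne_zero (hV0 j a ha)
        (Finset.prod_ne_zero_iff.2 fun i hi => hfac0 i ?_))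
      intro h
      exact Finset.ne_of_mem_erase hi (Subtype.ext h.symm)
    · filter_upwards [hU.mem_nhds haU] with z hz
      rw [hprod z hz, ← Finset.mul_prod_erase S _ (haS j rfl)]
      simp only [hj]
      ring

/-! ### Orders, divisibility and the Bézout property -/

variable {D : Set ℂ}

theorem analyticAt_ext (hD : IsOpen D) (f : Hol D) {a : ℂ} (ha : a ∈ D) :
    AnalyticAt ℂ (ext f.1) a :=
  DifferentiableOn.analyticAt (s := D) f.2 (hD.mem_nhds ha)

theorem ext_mul (f g : Hol D) : ext (f * g).1 = ext f.1 * ext g.1 := by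
  funext z
  by_cases hz : z ∈ D
  · simp [ext_apply _ hz]
  · have : ¬∃ a : D, (a : ℂ) = z := by simpa using hz
    simp [ext, Function.extend_apply' _ _ _ this]

theorem eventuallyEq_ext (hD : IsOpen D) {f : Hol D} {H : ℂ → ℂ} (h : ∀ z : D, f.1 z = H z)
    {a : ℂ} (ha : a ∈ D) : ext f.1 =ᶠ[𝓝 a] H := by
  filter_upwards [hD.mem_nhds ha] with z hz
  rw [ext_apply _ hz, h]

theorem exists_hol_eq {H : ℂ → ℂ} (hH : ∀ a ∈ D, AnalyticAt ℂ H a) :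
    ∃ f : Hol D, ∀ z : D, f.1 z = H z :=
  ⟨⟨fun z => H z, isHol_of_eqOn (fun a ha => (hH a ha).differentiableAt.differentiableWithinAt)
    fun _ => rfl⟩, fun _ => rfl⟩

theorem ord_mul (hD : IsOpen D) (f g : Hol D) (ζ : D) : ord (f * g) ζ = ord f ζ + ord g ζ := by
  rw [ord, ext_mul, analyticOrderAt_mul (analyticAt_ext hD f ζ.2) (analyticAt_ext hD g ζ.2)]
  rfl

theorem ord_zero (hD : IsOpen D) (ζ : D) : ord (0 : Hol D) ζ = ⊤ := by
  rw [ord, analyticOrderAt_eq_top]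
  exact eventuallyEq_ext (H := 0) hD (fun _ => rfl) ζ.2

theorem ord_one (hD : IsOpen D) (ζ : D) : ord (1 : Hol D) ζ = 0 := by
  rw [ord, (analyticAt_ext hD 1 ζ.2).analyticOrderAt_eq_zero, ext_apply _ ζ.2]
  exact one_ne_zero

theorem ord_pow (hD : IsOpen D) (f : Hol D) (n : ℕ) (ζ : D) : ord (f ^ n) ζ = n * ord f ζ := by
  induction n with
  | zero => simp [ord_one hD ζ]
  | succ n ih => rw [pow_succ, ord_mul hD, ih, Nat.cast_succ, add_mul, one_mul]

theorem ord_le_of_dvd (hD : IsOpen D) {f g : Hol D} (h : f ∣ g) (ζ : D) : ord f ζ ≤ ord g ζ := by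
  obtain ⟨q, rfl⟩ := h
  rw [ord_mul hD]
  exact le_self_add

theorem ord_eq_zero_iff (hD : IsOpen D) {f : Hol D} {ζ : D} : ord f ζ = 0 ↔ f.1 ζ ≠ 0 := by
  rw [ord, (analyticAt_ext hD f ζ.2).analyticOrderAt_eq_zero, ext_apply _ ζ.2]

theorem ord_ne_top (hD : IsOpen D) (hc : IsPreconnected D) {f : Hol D} (hf : f ≠ 0) (ζ : D) :
    ord f ζ ≠ ⊤ := by
  intro h
  rw [ord, analyticOrderAt_eq_top] at h
  refine hf (Subtype.ext (funext fun z => ?_))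
  have h1 : AnalyticOnNhd ℂ (ext f.1) D := fun a ha => analyticAt_ext hD f ha
  have := h1.eqOn_zero_of_preconnected_of_eventuallyEq_zero hc ζ.2 h z.2
  rwa [ext_apply _ z.2] at this

theorem finite_zeros (hD : IsOpen D) (hc : IsPreconnected D) {f : Hol D} (hf : f ≠ 0)
    {K : Set ℂ} (hKD : K ⊆ D) (hK : IsCompact K) : {z ∈ K | ext f.1 z = 0}.Finite := by
  by_contra hinf
  obtain ⟨a, ha, hacc⟩ := Set.Infinite.exists_accPt_of_subset_isCompact hinf hK
    (Set.sep_subset _ _)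
  rw [accPt_iff_frequently_nhdsNE] at hacc
  rcases (analyticAt_ext hD f (hKD ha)).eventually_eq_zero_or_eventually_ne_zero with h | h
  · exact ord_ne_top hD hc hf ⟨a, hKD ha⟩ (analyticOrderAt_eq_top.2 h)
  · obtain ⟨z, hz, hz'⟩ := (hacc.and_eventually h).exists
    exact hz' hz.2

theorem eventually_ne_zero (hD : IsOpen D) (hc : IsPreconnected D) {f : Hol D} (hf : f ≠ 0)
    {a : ℂ} (ha : a ∈ D) : ∀ᶠ z in 𝓝[≠] a, ext f.1 z ≠ 0 :=
  (analyticAt_ext hD f ha).eventually_eq_zero_or_eventually_ne_zero.resolve_left fun h =>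
    ord_ne_top hD hc hf ⟨a, ha⟩ (analyticOrderAt_eq_top.2 h)

/-- The zeros of `h` are isolated, so the local quotients `X` agree with `f / h` on punctured
neighbourhoods and glue to a global quotient. -/
theorem dvd_of_local (hD : IsOpen D) (hc : IsPreconnected D) {h f : Hol D} (hh : h ≠ 0)
    (hloc : ∀ a ∈ D, ∃ X, AnalyticAt ℂ X a ∧ ∀ᶠ z in 𝓝[≠] a, ext f.1 z = ext h.1 z * X z) :
    h ∣ f := by
  obtain ⟨H, hH⟩ := exists_analytic_of_local (D := D) (F := ext f.1 / ext h.1) fun a ha => by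
    obtain ⟨X, hX, hfX⟩ := hloc a ha
    refine ⟨X, hX, ?_⟩
    filter_upwards [hfX, eventually_ne_zero hD hc hh ha] with z h1 h2
    rw [Pi.div_apply, h1, mul_div_cancel_left₀ _ h2]
  obtain ⟨q, hq⟩ := exists_hol_eq fun a ha => (hH a ha).1
  refine ⟨q, Subtype.ext (funext fun a => ?_)⟩
  have ha := a.2
  have h1 : ∀ᶠ z in 𝓝[≠] (a : ℂ), ext f.1 z = ext h.1 z * H z := by
    filter_upwards [(hH a ha).2, eventually_ne_zero hD hc hh ha] with z h1 h2
    rw [← h1, Pi.div_apply, mul_div_cancel₀ _ h2]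
  have h2 := (AnalyticAt.frequently_eq_iff_eventually_eq (analyticAt_ext hD f ha)
    ((analyticAt_ext hD h ha).mul (hH a ha).1)).1 h1.frequently
  have h3 := h2.self_of_nhds
  rw [Pi.mul_apply, ext_apply _ ha, ext_apply _ ha] at h3
  rw [h3, ← hq]
  rfl

theorem dvd_of_ord_le (hD : IsOpen D) (hc : IsPreconnected D) {h f : Hol D} (hh : h ≠ 0)
    (hle : ∀ ζ, ord h ζ ≤ ord f ζ) : h ∣ f := by
  refine dvd_of_local hD hc hh fun a ha => ?_
  obtain ⟨g, hg, hg0, hhg⟩ := (analyticAt_ext hD h ha).analyticOrderAt_ne_top.1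
    (ord_ne_top hD hc hh ⟨a, ha⟩)
  obtain ⟨G, hG, hfG⟩ := (natCast_le_analyticOrderAt (analyticAt_ext hD f ha)).1
    ((ENat.natCast_toNat (ord_ne_top hD hc hh ⟨a, ha⟩)).trans_le (hle ⟨a, ha⟩))
  refine ⟨fun z => G z / g z, hG.div hg hg0, ?_⟩
  filter_upwards [mem_nhdsWithin_of_mem_nhds hhg, mem_nhdsWithin_of_mem_nhds hfG,
    mem_nhdsWithin_of_mem_nhds (hg.continuousAt.eventually_ne hg0)] with z h1 h2 h3
  rw [h1, h2]
  simp only [smul_eq_mul, analyticOrderNatAt, ord]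
  field_simp

/-- A function in `H(D)` with prescribed orders, supported on the zeros of a given function. -/
theorem exists_ord_eq (hD : IsOpen D) (hc : IsPreconnected D) (hne : D.Nonempty) {f : Hol D}
    (hf : f ≠ 0) (k : D → ℕ) (hk : ∀ ζ, f.1 ζ ≠ 0 → k ζ = 0) :
    ∃ h : Hol D, h ≠ 0 ∧ ∀ ζ, ord h ζ = k ζ := by
  classical
  obtain ⟨H, hH⟩ := weierstrass (k := fun z => if hz : z ∈ D then k ⟨z, hz⟩ else 0) hD
    fun K hKD hK => (finite_zeros hD hc hf hKD hK).subset fun z hz => by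
      refine ⟨hz.1, ?_⟩
      by_contra h0
      have hzD := hKD hz.1
      rw [ext_apply _ hzD] at h0
      have := hz.2
      simp only [hzD, dif_pos] at this
      exact this (hk _ h0)
  have hHa : ∀ a ∈ D, AnalyticAt ℂ H a := fun a ha => by
    obtain ⟨R, hR, -, h⟩ := hH a ha
    exact AnalyticAt.congr (AnalyticAt.mul (by fun_prop) hR) (EventuallyEq.symm h)
  obtain ⟨h, hh⟩ := exists_hol_eq hHa
  have hord : ∀ ζ, ord h ζ = k ζ := fun ζ => by
    obtain ⟨R, hR, hR0, hHR⟩ := hH ζ ζ.2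
    rw [ord, (analyticAt_ext hD h ζ.2).analyticOrderAt_eq_natCast]
    refine ⟨R, hR, hR0, ?_⟩
    filter_upwards [hHR, eventuallyEq_ext hD hh ζ.2] with z h1 h2
    rw [h2, h1]
    simp
  refine ⟨h, ?_, hord⟩
  rintro rfl
  obtain ⟨a, ha⟩ := hne
  have h1 := hord ⟨a, ha⟩
  rw [ord_zero hD] at h1
  exact ENat.top_ne_natCast _ h1

/-- Choose `b` holomorphic with `b * g ≡ 1` to the order of `f` at each zero of `f`; then `f ∣ 1 - b
* g`. Such a `b` is `f * m`, where Mittag-Leffler supplies `m` with the principal parts of `1 / (f *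
g)` at the zeros of `f`. -/
theorem isCoprime_of_no_common_zero (hD : IsOpen D) (hc : IsPreconnected D) {f g : Hol D}
    (hf : f ≠ 0) (hfg : ∀ ζ : D, f.1 ζ = 0 → g.1 ζ ≠ 0) : IsCoprime f g := by
  have hloc : ∀ a, ∃ p : ℂ → ℂ, Differentiable ℂ p ∧ (a ∈ D → ∃ P E, AnalyticAt ℂ P a ∧
      AnalyticAt ℂ E a ∧ ∀ᶠ z in 𝓝[≠] a,
        ext f.1 z * (p z / (z - a) ^ analyticOrderNatAt (ext f.1) a) = P z ∧
        1 - ext g.1 z * P z = ext f.1 z * E z) := by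
    intro a
    by_cases ha : a ∈ D
    swap
    · exact ⟨0, differentiable_const 0, fun h => absurd h ha⟩
    have hfa := analyticAt_ext hD f ha
    have hga := analyticAt_ext hD g ha
    by_cases hf0 : f.1 ⟨a, ha⟩ = 0
    · have hg0 : ext g.1 a ≠ 0 := by
        rw [ext_apply _ ha]
        exact hfg _ hf0
      obtain ⟨φ, hφ, hφ0, hfφ⟩ := hfa.analyticOrderAt_ne_top.1 (ord_ne_top hD hc hf ⟨a, ha⟩)
      -- Writing `f = (z - a) ^ k * φ`, expand `1 / (φ * g) = p + (z - a) ^ k * R`. Then `1 - g * φ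
      -- * p = f * g * R`, whence `P = φ * p` and `E = g * R`.
      obtain ⟨p, R, hp, hR, hpR⟩ := exists_entire_add_pow_mul
        ((hφ.mul hga).inv (mul_ne_zero hφ0 hg0)) (analyticOrderNatAt (ext f.1) a)
      refine ⟨p, hp, fun _ => ⟨fun z => φ z * p z, fun z => ext g.1 z * R z,
        hφ.mul (hp.analyticAt a), hga.mul hR, ?_⟩⟩
      filter_upwards [mem_nhdsWithin_of_mem_nhds hfφ, self_mem_nhdsWithin,
        mem_nhdsWithin_of_mem_nhds (hφ.continuousAt.eventually_ne hφ0),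
        mem_nhdsWithin_of_mem_nhds (hga.continuousAt.eventually_ne hg0)] with z h1 h2 h3 h4
      have h5 : (z - a) ^ analyticOrderNatAt (ext f.1) a ≠ 0 :=
        pow_ne_zero _ (sub_ne_zero.2 h2)
      have h6 := hpR z
      rw [h1, smul_eq_mul]
      refine ⟨by field_simp, ?_⟩
      have h7 : φ z * ext g.1 z * (φ * ext g.1)⁻¹ z = 1 := by
        simp only [Pi.inv_apply, Pi.mul_apply]
        field_simp
      rw [h6] at h7
      linear_combination -h7
    · have hfa0 : ext f.1 a ≠ 0 := by rwa [ext_apply _ ha]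
      refine ⟨0, differentiable_const 0, fun _ => ⟨0, fun z => (ext f.1 z)⁻¹, analyticAt_const,
        hfa.inv hfa0, ?_⟩⟩
      filter_upwards [mem_nhdsWithin_of_mem_nhds (hfa.continuousAt.eventually_ne hfa0)] with z h
      simp [h]
  choose p hp hpl using hloc
  obtain ⟨m, hm⟩ := mittag_leffler (k := analyticOrderNatAt (ext f.1)) hD
    (fun K hKD hK => (finite_zeros hD hc hf hKD hK).subset fun z hz => by
      refine ⟨hz.1, ?_⟩
      by_contra h0
      exact hz.2 (by
        rw [analyticOrderNatAt, ((analyticAt_ext hD f (hKD hz.1)).analyticOrderAt_eq_zero).2 h0]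
        rfl)) hp
  obtain ⟨v, hv⟩ := exists_analytic_of_local (D := D) (F := fun z => ext f.1 z * m z)
    fun a ha => by
      obtain ⟨P, E, hP, -, h⟩ := hpl a ha
      obtain ⟨R, hR, hmR⟩ := hm a ha
      refine ⟨fun z => P z + ext f.1 z * R z, hP.add ((analyticAt_ext hD f ha).mul hR), ?_⟩
      filter_upwards [h, hmR] with z h1 h2
      rw [h2, mul_add, h1.1]
  obtain ⟨b, hb⟩ := exists_hol_eq fun a ha => (hv a ha).1
  obtain ⟨q, hq⟩ : f ∣ 1 - b * g := by
    refine dvd_of_local hD hc hf fun a ha => ?_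
    obtain ⟨P, E, hP, hE, h⟩ := hpl a ha
    obtain ⟨R, hR, hmR⟩ := hm a ha
    refine ⟨fun z => E z - ext g.1 z * R z, hE.sub ((analyticAt_ext hD g ha).mul hR), ?_⟩
    filter_upwards [h, hmR, (hv a ha).2, mem_nhdsWithin_of_mem_nhds (hD.mem_nhds ha)]
      with z h1 h2 h3 hz
    have h4 : ext (1 - b * g).1 z = 1 - v z * ext g.1 z := by
      rw [ext_apply _ hz, ext_apply _ hz]
      change 1 - b.1 ⟨z, hz⟩ * g.1 ⟨z, hz⟩ = _
      rw [hb]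
    rw [h4, ← h3, h2]
    linear_combination h1.2 - ext g.1 z * h1.1
  exact ⟨q, b, by linear_combination -hq⟩

/-- `H(D)` is a Bézout ring. -/
theorem exists_gcd (hD : IsOpen D) (hc : IsPreconnected D) (hne : D.Nonempty) (f g : Hol D) :
    ∃ d, d ∣ f ∧ d ∣ g ∧ ∃ a b, a * f + b * g = d := by
  by_cases hf : f = 0
  · exact ⟨g, by simp [hf], dvd_rfl, 0, 1, by simp⟩
  by_cases hg : g = 0
  · exact ⟨f, dvd_rfl, by simp [hg], 1, 0, by simp⟩
  obtain ⟨d, hd0, hd⟩ := exists_ord_eq hD hc hne hf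
    (fun ζ => min (ord f ζ).toNat (ord g ζ).toNat) fun ζ hζ => by
      simp [(ord_eq_zero_iff hD).2 hζ]
  have hfT := ord_ne_top hD hc hf
  have hgT := ord_ne_top hD hc hg
  have hd' : ∀ ζ, ord d ζ = min (ord f ζ) (ord g ζ) := fun ζ => by
    obtain ⟨a, ha⟩ := ENat.ne_top_iff_exists.1 (hfT ζ)
    obtain ⟨b, hb⟩ := ENat.ne_top_iff_exists.1 (hgT ζ)
    rw [hd, ← ha, ← hb]
    exact Nat.mono_cast.map_min
  have hdf : d ∣ f := dvd_of_ord_le hD hc hd0 fun ζ => (hd' ζ).trans_le (min_le_left _ _)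
  have hdg : d ∣ g := dvd_of_ord_le hD hc hd0 fun ζ => (hd' ζ).trans_le (min_le_right _ _)
  refine ⟨d, hdf, hdg, ?_⟩
  obtain ⟨f', rfl⟩ := hdf
  obtain ⟨g', rfl⟩ := hdg
  have hf' : f' ≠ 0 := by
    rintro rfl
    simp at hf
  -- After cancelling the finite order of `d`, the minimum of the orders of `f'` and `g'` is zero,
  -- so they share no zero.
  obtain ⟨a, b, hab⟩ := isCoprime_of_no_common_zero hD hc hf' fun ζ h1 h2 => by
    have h1' : ord f' ζ ≠ 0 := fun h => (ord_eq_zero_iff hD).1 h h1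
    have h2' : ord g' ζ ≠ 0 := fun h => (ord_eq_zero_iff hD).1 h h2
    have h3 := hd' ζ
    rw [ord_mul hD, ord_mul hD, min_add_add_left] at h3
    have h4 : min (ord f' ζ) (ord g' ζ) = 0 := by
      have h5 := ord_ne_top hD hc hd0 ζ
      exact (ENat.addLECancellable_of_ne_top h5).inj.1 (by rw [← h3, add_zero])
    rcases min_choice (ord f' ζ) (ord g' ζ) with h | h
    · exact h1' (h ▸ h4)
    · exact h2' (h ▸ h4)
  exact ⟨a, b, by linear_combination d * hab⟩

/-! ### Maximal ideals and their Krull intersections -/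

variable {D : Set ℂ} {M : Ideal (Hol D)}

theorem exists_mem_zeroSet_of_mem (hD : IsOpen D) (hc : IsPreconnected D) (hM : M ≠ ⊤)
    {d : Hol D} (hd : d ∈ M) (hd0 : d ≠ 0) : ∃ ζ, d.1 ζ = 0 := by
  by_contra! h
  refine hM (M.eq_top_of_isUnit_mem hd (isUnit_of_dvd_one ?_))
  exact dvd_of_ord_le hD hc hd0 fun ζ => by simp [(ord_eq_zero_iff hD).2 (h ζ)]

/-- By Bézout, finitely many elements of `M` have a common divisor in `M`; it replaces all the
factors occurring in a sum of products. -/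
theorem exists_pow_dvd_of_mem_pow (hD : IsOpen D) (hc : IsPreconnected D) (hne : D.Nonempty)
    (n : ℕ) {f : Hol D} (hf : f ∈ M ^ n) : ∃ d ∈ M, d ^ n ∣ f := by
  have hgcd : ∀ f ∈ M, ∀ g ∈ M, ∃ d ∈ M, d ∣ f ∧ d ∣ g := fun f hf g hg => by
    obtain ⟨d, h1, h2, a, b, rfl⟩ := exists_gcd hD hc hne f g
    exact ⟨_, M.add_mem (M.mul_mem_left a hf) (M.mul_mem_left b hg), h1, h2⟩
  induction n generalizing f with
  | zero => exact ⟨0, M.zero_mem, by simp⟩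
  | succ n ih =>
    rw [pow_succ] at hf
    induction hf using Submodule.mul_induction_on' with
    | mem_mul_mem x hx y hy =>
      obtain ⟨d, hd, hdx⟩ := ih hx
      obtain ⟨e, he, hed, hey⟩ := hgcd d hd y hy
      exact ⟨e, he, pow_succ e n ▸ mul_dvd_mul ((pow_dvd_pow_of_dvd hed n).trans hdx) hey⟩
    | add x _ y _ hx hy =>
      obtain ⟨d, hd, hdx⟩ := hx
      obtain ⟨e, he, hey⟩ := hy
      obtain ⟨c, hc, hcd, hce⟩ := hgcd d hd e he
      exact ⟨c, hc, dvd_add ((pow_dvd_pow_of_dvd hcd _).trans hdx)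
        ((pow_dvd_pow_of_dvd hce _).trans hey)⟩

theorem subPoint_ne_zero (hD : IsOpen D) {ζ : ℂ} (hζ : ζ ∈ D) : subPoint D ζ ≠ 0 := by
  intro h
  have h1 : ∀ᶠ z in 𝓝[≠] ζ, z ∈ D ∧ z ≠ ζ :=
    Filter.Eventually.and (mem_nhdsWithin_of_mem_nhds (hD.mem_nhds hζ)) self_mem_nhdsWithin
  obtain ⟨z, hz, hne⟩ := h1.exists
  have := congrArg (fun f : Hol D => f.1 ⟨z, hz⟩) h
  exact hne (sub_eq_zero.1 this)

theorem ord_subPoint (hD : IsOpen D) (ζ : D) : ord (subPoint D ζ) ζ = 1 := by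
  rw [ord, analyticOrderAt_congr (eventuallyEq_ext (H := id - fun _ => (ζ : ℂ)) hD
    (fun _ => rfl) ζ.2)]
  exact analyticOrderAt_id_sub_const_self

theorem subPoint_dvd (hD : IsOpen D) (hc : IsPreconnected D) {f : Hol D} {ζ : D}
    (hf : f.1 ζ = 0) : subPoint D ζ ∣ f := by
  refine dvd_of_ord_le hD hc (subPoint_ne_zero hD ζ.2) fun z => ?_
  by_cases hz : z = ζ
  · rw [hz, ord_subPoint hD, Order.one_le_iff_ne_zero]
    exact fun h => (ord_eq_zero_iff hD).1 h hf
  · have : ord (subPoint D ζ) z = 0 := (ord_eq_zero_iff hD).2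
      (sub_ne_zero.2 fun h => hz (Subtype.ext h))
    simp [this]

theorem subPoint_not_isUnit (ζ : D) : ¬IsUnit (subPoint D ζ) := by
  rintro h
  obtain ⟨g, hg⟩ := h.exists_right_inv
  have := congrArg (fun f : Hol D => f.1 ζ) hg
  change ((ζ : ℂ) - ζ) * g.1 ζ = 1 at this
  simp at this

theorem eq_span_subPoint (hD : IsOpen D) (hc : IsPreconnected D) (hM : M.IsMaximal) {ζ : D}
    (h : ζ ∈ idealZeroSet M) : M = Ideal.span {subPoint D ζ} := by
  refine hM.eq_of_le (mt Ideal.span_singleton_eq_top.1 (subPoint_not_isUnit ζ)) fun f hf => ?_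
  rw [Ideal.mem_span_singleton]
  exact subPoint_dvd hD hc (Set.mem_iInter₂.1 h f hf)

theorem subPoint_notMem (hD : IsOpen D) (hc : IsPreconnected D) (hM : M ≠ ⊤) (hfree : IsFree M)
    (ζ : D) : subPoint D ζ ∉ M := by
  intro h
  refine Set.notMem_empty ζ (hfree ▸ ?_)
  refine Set.mem_iInter₂.2 fun f hf => ?_
  change f.1 ζ = 0
  by_contra h0
  -- If `z - ζ` were in `M`, so would `f - f(ζ)` be, and with it the nonzero constant `f(ζ)`.
  have h1 : f - algebraMap ℂ (Hol D) (f.1 ζ) ∈ M :=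
    M.mem_of_dvd (subPoint_dvd hD hc (sub_self (f.1 ζ))) h
  have h2 : algebraMap ℂ (Hol D) (f.1 ζ) ∈ M := by
    simpa using M.sub_mem hf h1
  exact hM (M.eq_top_of_isUnit_mem h2 ((isUnit_iff_ne_zero.2 h0).map (algebraMap ℂ (Hol D))))

theorem mem_ki {R : Type*} [CommRing R] {I : Ideal R} {f : R} :
    f ∈ ki I ↔ ∀ n, 1 ≤ n → f ∈ I ^ n := by
  simp [ki]

theorem mem_ki_of_ordTendsToInfty (hD : IsOpen D) (hc : IsPreconnected D) (hne : D.Nonempty)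
    (hM : M.IsMaximal) (hfree : IsFree M) {f : Hol D} (hfM : f ∈ M) (hf : f ≠ 0)
    (hlim : OrdTendsToInfty f) : f ∈ ki M := by
  refine mem_ki.2 fun n hn => ?_
  obtain ⟨h, hh0, hh⟩ := exists_ord_eq hD hc hne hf (fun ζ => (ord f ζ).toNat / n)
    fun ζ hζ => by simp [(ord_eq_zero_iff hD).2 hζ]
  have hcast : ∀ ζ, ((ord f ζ).toNat : ℕ∞) = ord f ζ := fun ζ =>
    ENat.natCast_toNat (ord_ne_top hD hc hf ζ)
  have hhf : h ^ n ∣ f := by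
    refine dvd_of_ord_le hD hc ?_ fun ζ => ?_
    · intro h0
      obtain ⟨a, ha⟩ := hne
      have h1 := ord_pow hD h n ⟨a, ha⟩
      rw [h0, ord_zero hD, hh, ← Nat.cast_mul] at h1
      exact ENat.top_ne_natCast _ h1
    · rw [ord_pow hD, hh, ← hcast ζ, ← Nat.cast_mul, ENat.toNat_natCast]
      exact_mod_cast Nat.mul_div_le _ _
  obtain ⟨K, hK, -, hKord⟩ := hlim n hn
  set P : Hol D := ∏ ζ ∈ hK.toFinset, subPoint D ζ ^ (ord f ζ).toNat with hP
  -- `P` takes care of the exceptional zeros. At the others `ord f > n`, so `q = ⌊ord f / n⌋ ≥ 1`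
  -- and `ord f < (q + 1) * n ≤ 2 * n * q`.
  have hdvd : f ∣ P * h ^ (2 * n) := by
    refine dvd_of_ord_le hD hc hf fun ζ => ?_
    rw [ord_mul hD, ord_pow hD, hh]
    by_cases hζ : ζ ∈ K
    · refine le_trans ?_ le_self_add
      have h1 : subPoint D ζ ^ (ord f ζ).toNat ∣ P :=
        Finset.dvd_prod_of_mem (fun ζ : D => subPoint D ζ ^ (ord f ζ).toNat)
          (hK.mem_toFinset.2 hζ)
      have h2 := ord_le_of_dvd hD h1 ζ
      rwa [ord_pow hD, ord_subPoint hD, mul_one, hcast] at h2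
    · refine le_trans ?_ le_add_self
      by_cases h0 : f.1 ζ = 0
      · have h1 := hKord ζ ⟨h0, hζ⟩
        rw [← hcast ζ] at h1 ⊢
        have h2 : n < (ord f ζ).toNat := by exact_mod_cast h1
        rw [ENat.toNat_natCast]
        have h3 := Nat.div_add_mod (ord f ζ).toNat n
        have h4 := Nat.mod_lt (ord f ζ).toNat hn
        have h5 : 1 ≤ (ord f ζ).toNat / n := (Nat.one_le_div_iff hn).2 h2.le
        have h6 : (ord f ζ).toNat ≤ 2 * n * ((ord f ζ).toNat / n) := by nlinarith
        exact_mod_cast h6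
      · simp [(ord_eq_zero_iff hD).2 h0]
  have hprime := hM.isPrime
  have hPM : P ∉ M := by
    intro h
    obtain ⟨ζ, -, h⟩ := Ideal.IsPrime.prod_mem_iff.1 h
    exact subPoint_notMem hD hc hM.ne_top hfree ζ (hprime.mem_of_pow_mem _ h)
  have hhM : h ∈ M := hprime.mem_of_pow_mem _
    ((hprime.mem_or_mem (M.mem_of_dvd hdvd hfM)).resolve_left hPM)
  exact (M ^ n).mem_of_dvd hhf (Ideal.pow_mem_pow hhM n)

theorem iSup_ord_eq_top_of_mem_ki (hD : IsOpen D) (hc : IsPreconnected D) (hne : D.Nonempty)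
    (hM : M ≠ ⊤) {f : Hol D} (hf : f ≠ 0) (hk : f ∈ ki M) :
    (⨆ ζ ∈ zeroSet f, ord f ζ : ℕ∞) = ⊤ := by
  refine ENat.eq_top_iff_forall_ge.2 fun n => ?_
  -- The exponent `n + 1` rather than `n` keeps it positive, which forces `d ≠ 0` and makes the zero
  -- of `d` a zero of `f`.
  obtain ⟨d, hd, hdf⟩ := exists_pow_dvd_of_mem_pow hD hc hne (n + 1) (mem_ki.1 hk (n + 1) (by simp))
  have hd0 : d ≠ 0 := by
    rintro rfl
    rw [zero_pow n.succ_ne_zero, zero_dvd_iff] at hdf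
    exact hf hdf
  obtain ⟨ζ, hζ⟩ := exists_mem_zeroSet_of_mem hD hc hM hd hd0
  have h1 : 1 ≤ ord d ζ := Order.one_le_iff_ne_zero.2 fun h => (ord_eq_zero_iff hD).1 h hζ
  have h2 : ((n + 1 : ℕ) : ℕ∞) ≤ ord f ζ := by
    refine le_trans ?_ (ord_le_of_dvd hD hdf ζ)
    rw [ord_pow hD]
    exact le_mul_of_one_le_right' h1
  have h3 : ζ ∈ zeroSet f := by
    by_contra h
    rw [(ord_eq_zero_iff hD).2 h] at h2
    exact absurd h2 (by simp)
  calc (n : ℕ∞) ≤ (n + 1 : ℕ) := by exact_mod_cast n.le_succ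
    _ ≤ ord f ζ := h2
    _ ≤ _ := le_iSup₂ (f := fun ζ (_ : ζ ∈ zeroSet f) => ord f ζ) ζ h3

theorem ki_ne_bot_of_isFree (hD : IsOpen D) (hc : IsPreconnected D) (hne : D.Nonempty)
    (hM : M.IsMaximal) (hfree : IsFree M) : ki M ≠ ⊥ := by
  classical
  obtain ⟨f, hfM, hf⟩ : ∃ f ∈ M, f ≠ 0 := by
    by_contra! h
    obtain ⟨a, ha⟩ := hne
    refine Set.notMem_empty (⟨a, ha⟩ : D) (hfree ▸ Set.mem_iInter₂.2 fun f hf => ?_)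
    rw [h f hf]
    rfl
  obtain ⟨K, hKc, hKD, -, hK⟩ := exists_compact_exhaustion hD
  have hex : ∀ ζ : D, ∃ n, (ζ : ℂ) ∈ K n := fun ζ => by
    obtain ⟨n, hn⟩ := hK {(ζ : ℂ)} (by simp) isCompact_singleton
    exact ⟨n, hn rfl⟩
  -- The index of the first exhausting set containing `ζ` tends to infinity along the zeros. Adding
  -- `1` ensures `f ∣ h` even at index `0`, and makes the order exceed `n` from index `n` on.
  obtain ⟨h, hh0, hh⟩ := exists_ord_eq hD hc hne hf
    (fun ζ => (Nat.find (hex ζ) + 1) * (ord f ζ).toNat)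
    fun ζ hζ => by simp [(ord_eq_zero_iff hD).2 hζ]
  have hcast : ∀ ζ, ((ord f ζ).toNat : ℕ∞) = ord f ζ := fun ζ =>
    ENat.natCast_toNat (ord_ne_top hD hc hf ζ)
  have hfh : f ∣ h := dvd_of_ord_le hD hc hf fun ζ => by
    rw [hh, ← hcast ζ, ENat.toNat_natCast]
    exact_mod_cast Nat.le_mul_of_pos_left _ (Nat.succ_pos _)
  have hzero : ∀ ζ ∈ zeroSet h, f.1 ζ = 0 := fun ζ hζ => by
    by_contra h0
    have h1 := hh ζ
    rw [(ord_eq_zero_iff hD).2 h0] at h1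
    exact (ord_eq_zero_iff hD).1 (by simpa using h1) hζ
  have hlim : OrdTendsToInfty h := fun n _ => by
    refine ⟨{ζ | ζ ∈ zeroSet h ∧ Nat.find (hex ζ) < n}, ?_, fun ζ hζ => hζ.1, ?_⟩
    · refine Set.Finite.of_finite_image (Set.Finite.subset (Set.finite_iUnion fun j : Fin n =>
        finite_zeros hD hc hf (hKD j) (hKc j)) ?_) Subtype.val_injective.injOn
      rintro _ ⟨ζ, ⟨h1, h2⟩, rfl⟩
      refine Set.mem_iUnion.2 ⟨⟨_, h2⟩, Nat.find_spec (hex ζ), ?_⟩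
      rw [ext_apply _ ζ.2]
      exact hzero ζ h1
    · rintro ζ ⟨h1, h2⟩
      have h3 : n ≤ Nat.find (hex ζ) := not_lt.1 fun h3 => h2 ⟨h1, h3⟩
      have h4 : 1 ≤ (ord f ζ).toNat := by
        rw [Nat.one_le_iff_ne_zero]
        intro h4
        have h5 := hcast ζ
        rw [h4] at h5
        exact (ord_eq_zero_iff hD).1 h5.symm (hzero ζ h1)
      rw [hh]
      have h5 : n < (Nat.find (hex ζ) + 1) * (ord f ζ).toNat := by nlinarith
      exact_mod_cast h5
  intro hbot
  have := mem_ki_of_ordTendsToInfty hD hc hne hM hfree (M.mem_of_dvd hfh hfM) hh0 hlim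
  rw [hbot] at this
  exact hh0 this

theorem ki_span_subPoint (hD : IsOpen D) (hc : IsPreconnected D) {ζ : ℂ} (hζ : ζ ∈ D) :
    ki (Ideal.span {subPoint D ζ}) = ⊥ := by
  refine (Submodule.eq_bot_iff _).2 fun f hf => ?_
  by_contra h0
  refine ord_ne_top hD hc h0 ⟨ζ, hζ⟩ (ENat.eq_top_iff_forall_ge.2 fun n => ?_)
  have h1 := mem_ki.1 hf (n + 1) (by simp)
  rw [Ideal.span_singleton_pow, Ideal.mem_span_singleton] at h1
  have h2 := ord_le_of_dvd hD ((pow_dvd_pow _ n.le_succ).trans h1) ⟨ζ, hζ⟩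
  rwa [ord_pow hD, ord_subPoint hD ⟨ζ, hζ⟩, mul_one] at h2

end KrullHol

theorem mainTheorem2 (D : Set ℂ) (hD : IsOpen D) (hDc : IsPathConnected D)
    (M : Ideal (KrullHol.Hol D)) (hM : M.IsMaximal) :
    (KrullHol.IsFree M →
      {0} ∪ {f : KrullHol.Hol D | f ∈ M ∧ f ≠ 0 ∧ KrullHol.OrdTendsToInfty f} ⊆
          (KrullHol.ki M : Set (KrullHol.Hol D)) ∧
      (KrullHol.ki M : Set (KrullHol.Hol D)) ⊆
          {0} ∪ {f : KrullHol.Hol D | f ∈ M ∧ f ≠ 0 ∧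
            (⨆ ζ ∈ KrullHol.zeroSet f, KrullHol.ord f ζ : ℕ∞) = ⊤}) ∧
    (KrullHol.ki M = ⊥ ↔ ∃ ζ ∈ D, M = Ideal.span {KrullHol.subPoint D ζ}) := by
  have hc : IsPreconnected D := hDc.isConnected.isPreconnected
  have hne : D.Nonempty := hDc.nonempty
  refine ⟨fun hfree => ⟨?_, ?_⟩, fun hbot => ?_, ?_⟩
  · rintro f (rfl | ⟨hfM, hf, hlim⟩)
    · exact Submodule.zero_mem _
    · exact KrullHol.mem_ki_of_ordTendsToInfty hD hc hne hM hfree hfM hf hlim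
  · intro f hf
    by_cases h0 : f = 0
    · exact Or.inl h0
    · have hfM : f ∈ M := by simpa using KrullHol.mem_ki.1 hf 1 le_rfl
      exact Or.inr ⟨hfM, h0, KrullHol.iSup_ord_eq_top_of_mem_ki hD hc hne hM.ne_top h0 hf⟩
  · have hnf : ¬KrullHol.IsFree M := fun h => KrullHol.ki_ne_bot_of_isFree hD hc hne hM h hbot
    obtain ⟨ζ, hζ⟩ := Set.nonempty_iff_ne_empty.2 hnf
    exact ⟨ζ, ζ.2, KrullHol.eq_span_subPoint hD hc hM hζ⟩
  · rintro ⟨ζ, hζ, rfl⟩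
    exact KrullHol.ki_span_subPoint hD hc hζ
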